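/- Let $p$ be a prime, $n=p^2$, and let $k$ be a field of characteristic $p$. Write $P_n^k=k[X_1,\dots,X_n]$ and $R_n^k=k[X_1,\dots,X_n,Y_1,\dots,Y_n]$. For $1\le s\le n$ and $m\ge 0$ let $\partial_{X_s}^{(m)}=\frac1{m!}\left(\frac{\partial}{\partial X_s}\right)^m$ be the divided differential operator (defined over $\mathbb Z$ and extended to $k$), that is, the $k$-linear operator on $P_n^k$ with $X^{a}\mapsto\binom{a_s}{m}X^{a-m\delta_s}$, where $\delta_s$ is the $s$-th unit vector. Let $\mathbb D_n^k$ be the $k$-algebra of operators on $P_n^k$ generated by all the $\partial_{X_s}^{(m)}$. Let $\Delta_n=\prod_{1\le s<t\le n}(X_s-X_t)$ be the Vandermonde determinant, put $\mathbb D_n^k(\Delta_n)=\{D(\Delta_n): D\in\mathbb D_n^k\}\subset P_n^k$, and put $\mathrm{Diff}_n(\Delta_n)=\mathbb C[\partial_{X_1},\dots,\partial_{X_n}]\cdot\Delta_n\subset\mathbb C[X_1,\dots,X_n]$ (a space well known to have dimension $n!$). Let $\mathfrak b_p: p\ge p\ge\cdots\ge p$ ($p$ parts) be the box partition of $n$,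 with diagram $D=\{(i,j)\in\mathbb Z_{\ge0}^2: i,j<p\}$. For any ordering $(i_1,j_1),\dots,(i_n,j_n)$ of $D$ let $\Delta_{\mathfrak b_p}=\det\left[X_s^{i_t}Y_s^{j_t}\right]_{1\le s,t\le n}$, a polynomial with integer coefficients, and put $$V_n^k=k[\partial_{X_1},\dots,\partial_{X_n},\partial_{Y_1},\dots,\partial_{Y_n}](\Delta_{\mathfrak b_p})\subset R_n^k,\qquad \mathrm{Diff}_{2n}(\Delta_{\mathfrak b_p})=\mathbb C[\partial_{X_1},\dots,\partial_{X_n},\partial_{Y_1},\dots,\partial_{Y_n}](\Delta_{\mathfrak b_p}).$$ **Theorem.** Suppose that $$\dim_k\mathbb D_n^k(\Delta_n)=\dim_{\mathbb C}\mathrm{Diff}_n(\Delta_n)$$ (the conjectured equality for this $n=p^2$ and this $k$). Then $$\dim_k V_n^k=n!\qquad\text{and}\qquad \dim_{\mathbb C}\mathrm{Diff}_{2n}(\Delta_{\mathfrak b_p})=n!,$$ the latter being the $n!$ result for the box partition $\mathfrak b_p$. -/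

import Mathlib

open scoped Nat

noncomputable section

namespace BoxPartition

open MvPolynomial

/-- The divided differential operator `∂_s^{(m)} = (1/m!) (∂/∂X_s)^m` on polynomials in the
variables indexed by `ι`: the `k`-linear map with
`X^a ↦ (a_s choose m) X^{a - m δ_s}` (zero if `a_s < m`). -/
def dividedDeriv {ι : Type*} (k : Type*) [CommRing k] (s : ι) (m : ℕ) :
    MvPolynomial ι k →ₗ[k] MvPolynomial ι k :=
  (basisMonomials ι k).constr k fun a =>
    monomial (a - Finsupp.single s m) ((a s).choose m : k)

theorem dividedDeriv_monomial {ι : Type*} {k : Type*} [CommRing k] (s : ι) (m : ℕ)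
    (a : ι →₀ ℕ) (c : k) :
    dividedDeriv k s m (monomial a c)
      = monomial (a - Finsupp.single s m) (((a s).choose m : k) * c) := by
  have h : monomial a c = c • basisMonomials ι k a := by
    simp [smul_monomial]
  rw [h, map_smul, dividedDeriv, Module.Basis.constr_basis, smul_monomial, smul_eq_mul, mul_comm]

/-- `m! ∂_s^{(m)} = (∂/∂X_s)^m`. -/
theorem factorial_smul_dividedDeriv {ι : Type*} {k : Type*} [CommRing k] (s : ι) (m : ℕ)
    (f : MvPolynomial ι k) :
    (m ! : k) • dividedDeriv k s m f = (pderiv s)^[m] f := by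
  induction f using MvPolynomial.induction_on' with
  | monomial a c =>
    have h : ∀ m : ℕ, (pderiv s)^[m] (monomial a c)
        = monomial (a - Finsupp.single s m) (((a s).descFactorial m : k) * c) := by
      intro m
      induction m with
      | zero => simp
      | succ m ih =>
        rw [Function.iterate_succ_apply', ih, pderiv_monomial, Nat.descFactorial_succ,
          tsub_tsub, ← Finsupp.single_add]
        congr 1
        simp only [Finsupp.coe_tsub, Pi.sub_apply, Finsupp.single_eq_same]
        push_cast
        ring
    rw [h, dividedDeriv_monomial, smul_monomial, Nat.descFactorial_eq_factorial_mul_choose]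
    simp [mul_assoc]
  | add f g hf hg =>
    have h : ∀ m : ℕ, (pderiv s)^[m] (f + g) = (pderiv s)^[m] f + (pderiv s)^[m] g :=
      fun m => iterate_map_add (pderiv s) m f g
    rw [map_add, smul_add, hf, hg, h]

/-- The divided operators over `k` are obtained from those over `ℤ` by extension of scalars. -/
theorem dividedDeriv_map {ι : Type*} {k : Type*} [CommRing k] (s : ι) (m : ℕ)
    (f : MvPolynomial ι ℤ) :
    dividedDeriv k s m (map (Int.castRingHom k) f)
      = map (Int.castRingHom k) (dividedDeriv ℤ s m f) := by
  induction f using MvPolynomial.induction_on' with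
  | monomial a c => simp [dividedDeriv_monomial, map_monomial]
  | add f g hf hg => simp only [map_add, hf, hg]

/-- The algebra `k[∂_i : i ∈ ι]` of constant coefficient differential operators, as an algebra of
`k`-linear operators on the polynomial ring. -/
def diffAlg (ι k : Type*) [CommRing k] : Subalgebra k (Module.End k (MvPolynomial ι k)) :=
  Algebra.adjoin k (Set.range fun i : ι => (pderiv i : Derivation k _ _).toLinearMap)

/-- The algebra of all divided differential operators: the `k`-algebra of operators on the
polynomial ring generated by all `∂_s^{(m)}`. -/
def dividedDiffAlg (ι k : Type*) [CommRing k] : Subalgebra k (Module.End k (MvPolynomial ι k)) :=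
  Algebra.adjoin k (Set.range fun sm : ι × ℕ => dividedDeriv k sm.1 sm.2)

/-- The space `A(v) = {D v : D ∈ A}` for an algebra `A` of `k`-linear operators on `M`. -/
def orbit {k M : Type*} [CommRing k] [AddCommGroup M] [Module k M]
    (A : Subalgebra k (Module.End k M)) (v : M) : Submodule k M :=
  (Subalgebra.toSubmodule A).map (LinearMap.applyₗ v)

theorem mem_orbit {k M : Type*} [CommRing k] [AddCommGroup M] [Module k M]
    (A : Subalgebra k (Module.End k M)) (v w : M) : w ∈ orbit A v ↔ ∃ D ∈ A, D v = w :=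
  Iff.rfl

/-- The Vandermonde determinant `Δ_n = ∏_{s < t} (X_s - X_t)`. -/
def vandermonde (n : ℕ) (k : Type*) [CommRing k] : MvPolynomial (Fin n) k :=
  ∏ s : Fin n, ∏ t ∈ Finset.Ioi s, (X s - X t)

/-- The parts `σ_0 ≥ σ_1 ≥ ⋯` of a partition, with `σ_j = 0` beyond the last part. -/
def part {n : ℕ} (σ : n.Partition) (j : ℕ) : ℕ :=
  (σ.parts.sort (· ≥ ·)).getD j 0

/-- The diagram `D_σ = {(i, j) : i < σ_j}`. -/
def diagram {n : ℕ} (σ : n.Partition) : Set (ℕ × ℕ) :=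
  {c | c.1 < part σ c.2}

/-- The polynomial `Δ_σ = det [X_s^{i_t} Y_s^{j_t}]`, where `t ↦ (i_t, j_t)` is a chosen ordering
of the diagram of `σ`.  The variables `X_s` and `Y_s` are indexed by `Sum.inl s` and
`Sum.inr s`. -/
def deltaPoly {n : ℕ} (σ : n.Partition) (e : Fin n ≃ diagram σ) (k : Type*) [CommRing k] :
    MvPolynomial (Fin n ⊕ Fin n) k :=
  Matrix.det (Matrix.of fun s t : Fin n =>
    (X (Sum.inl s) ^ (e t).1.1 * X (Sum.inr s) ^ (e t).1.2 : MvPolynomial (Fin n ⊕ Fin n) k))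

/-- The box partition `p ≥ p ≥ ⋯ ≥ p` of `p ^ 2` (with `p` parts). -/
def box (p : ℕ) : (p ^ 2).Partition where
  parts := Multiset.replicate p p
  parts_pos := by
    intro i hi
    obtain ⟨h, rfl⟩ := Multiset.mem_replicate.1 hi
    exact Nat.pos_of_ne_zero h
  parts_sum := by simp [pow_two]

end BoxPartition

end

noncomputable section

namespace BoxPartition

open MvPolynomial

/-! Everything follows from a chain of inequalities that starts and ends at `n!`, for `n = p ^ 2`:
`n! ≤ dim_ℂ Diff(Δ_n) = dim_k 𝔻(Δ_n) = dim_k V ≤ dim_ℂ Diff(Δ_box) ≤ n!`.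

The first equality is the conjectural hypothesis. The second is Lucas' theorem: writing exponents
below `p ^ 2` in base `p` turns `X ^ (i + p j)` into `X ^ i Y ^ j`. Under this injection `Δ_n`
becomes `± Δ_box`, and `∂^{(m)}` becomes the product of the divided derivatives in `X` and `Y` whose
orders are the digits of `m`. Those orders are below `p`, so they are ordinary differential
operators up to invertible scalars (`map_digitMap_orbit`).

The inequality between characteristics holds because the derivatives of `Δ_box` are integral and
rank can only drop on reduction (`finrank_orbit_map_le_of_charZero`). The lower bound counts
divisors of the leading monomial of `Δ_n` (`factorial_le_finrank_orbit_vandermonde`).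

The upper bound comes from a point whose `n` pairs of coordinates are all the pairs of `p`-th roots
of unity. Its orbit under the symmetric group is indexed by the `n!` permutations. Alternating sums
of monomials over this orbit recover the coefficients of `Δ_box` up to one nonzero determinant, so
independent derivatives give independent functions on the orbit (`linearIndependent_rootEval`). -/

/-! ### Monomial derivatives and the spaces they span. -/

/-- The operator `∂^a = ∏ s, (∂/∂X_s)^(a s)`, given by its values on monomials. -/
def monomialDeriv {ι : Type*} [Fintype ι] (k : Type*) [CommRing k] (a : ι →₀ ℕ) :
    Module.End k (MvPolynomial ι k) :=
  (basisMonomials ι k).constr k fun m =>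
    monomial (m - a) ((∏ s, (m s).descFactorial (a s) : ℕ) : k)

section monomialDeriv

variable {ι : Type*} [Fintype ι] {k : Type*} [CommRing k]

theorem monomialDeriv_monomial (a m : ι →₀ ℕ) (c : k) :
    monomialDeriv k a (monomial m c)
      = monomial (m - a) (((∏ s, (m s).descFactorial (a s) : ℕ) : k) * c) := by
  have h : monomial m c = c • basisMonomials ι k m := by
    simp [smul_monomial]
  rw [h, map_smul, monomialDeriv, Module.Basis.constr_basis, smul_monomial, smul_eq_mul, mul_comm]

theorem monomialDeriv_zero : monomialDeriv k (0 : ι →₀ ℕ) = 1 := by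
  refine MvPolynomial.linearMap_ext fun m => LinearMap.ext fun c => ?_
  simp [monomialDeriv_monomial]

theorem pderiv_monomialDeriv (a : ι →₀ ℕ) (s : ι) (f : MvPolynomial ι k) :
    pderiv s (monomialDeriv k a f) = monomialDeriv k (a + Finsupp.single s 1) f := by
  classical
  induction f using MvPolynomial.induction_on' with
  | monomial m c =>
    rw [monomialDeriv_monomial, monomialDeriv_monomial, pderiv_monomial, tsub_tsub]
    have h : ∏ t, (m t).descFactorial ((a + Finsupp.single s 1 : ι →₀ ℕ) t)
        = (∏ t, (m t).descFactorial (a t)) * (m s - a s) := by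
      rw [← Fintype.prod_ite_eq' s fun t => m t - a t, ← Finset.prod_mul_distrib]
      refine Finset.prod_congr rfl fun t _ => ?_
      by_cases hts : t = s
      · subst hts
        simp [Nat.descFactorial_succ, mul_comm]
      · simp [hts]
    rw [h]
    congr 1
    simp only [Finsupp.coe_tsub, Pi.sub_apply]
    push_cast
    ring
  | add f g hf hg => simp only [map_add, hf, hg]

theorem monomialDeriv_map {R S : Type*} [CommRing R] [CommRing S] (g : R →+* S) (a : ι →₀ ℕ)
    (f : MvPolynomial ι R) :
    monomialDeriv S a (map g f) = map g (monomialDeriv R a f) := by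
  induction f using MvPolynomial.induction_on' with
  | monomial m c => simp [monomialDeriv_monomial, map_monomial]
  | add f g hf hg => simp only [map_add, hf, hg]

/-- Clearing denominators in the ratio of factorials gives a form without truncated subtraction, in
which coefficients of a derivative are read off from those of `f`. -/
theorem prod_factorial_mul_coeff_monomialDeriv (a m : ι →₀ ℕ) (f : MvPolynomial ι k) :
    ((∏ s, (m s)! : ℕ) : k) * coeff m (monomialDeriv k a f)
      = ((∏ s, ((m + a) s)! : ℕ) : k) * coeff (m + a) f := by
  classical
  induction f using MvPolynomial.induction_on' with
  | monomial b c =>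
    rw [monomialDeriv_monomial, coeff_monomial, coeff_monomial]
    by_cases hb : b = m + a
    · subst hb
      rw [if_pos rfl, if_pos (add_tsub_cancel_right m a), ← mul_assoc, ← Nat.cast_mul,
        ← Finset.prod_mul_distrib]
      congr 2
      refine Finset.prod_congr rfl fun s _ => ?_
      have := Nat.factorial_mul_descFactorial (n := (m + a) s) (k := a s) (by simp)
      simpa using this
    · rw [if_neg hb]
      split_ifs with h
      · obtain ⟨s, hs⟩ : ∃ s, b s < a s := by
          by_contra! hle
          exact hb (by rw [← h, tsub_add_cancel_of_le hle])
        rw [Finset.prod_eq_zero (f := fun s => (b s).descFactorial (a s)) (Finset.mem_univ s)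
          (Nat.descFactorial_of_lt hs)]
        simp
      · simp
  | add f g hf hg => simp only [map_add, coeff_add, mul_add, hf, hg]

theorem diffAlg_eq_span :
    Subalgebra.toSubmodule (diffAlg ι k) = Submodule.span k (Set.range (monomialDeriv k)) := by
  classical
  apply le_antisymm
  · intro D hD
    have hmul : ∀ s : ι, ∀ E ∈ Submodule.span k (Set.range (monomialDeriv (ι := ι) k)),
        (pderiv s : Derivation k (MvPolynomial ι k) _).toLinearMap * E
          ∈ Submodule.span k (Set.range (monomialDeriv (ι := ι) k)) := by
      intro s E hE
      induction hE using Submodule.span_induction with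
      | mem x hx =>
        obtain ⟨a, rfl⟩ := hx
        refine Submodule.subset_span ⟨a + Finsupp.single s 1, LinearMap.ext fun f => ?_⟩
        exact (pderiv_monomialDeriv a s f).symm
      | zero => simp
      | add x y _ _ hx hy => rw [mul_add]; exact add_mem hx hy
      | smul c x _ hx => rw [mul_smul_comm]; exact Submodule.smul_mem _ c hx
    have hD' : D ∈ diffAlg ι k := hD
    -- Stability of the span under left multiplication by `D` passes through products, unlike bare
    -- membership of `D`; applying it to `1` recovers membership.
    suffices ∀ E ∈ Submodule.span k (Set.range (monomialDeriv (ι := ι) k)),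
        D * E ∈ Submodule.span k (Set.range (monomialDeriv (ι := ι) k)) by
      simpa using this 1 (Submodule.subset_span ⟨0, monomialDeriv_zero⟩)
    induction hD' using Algebra.adjoin_induction with
    | mem x hx =>
      obtain ⟨s, rfl⟩ := hx
      exact hmul s
    | algebraMap r =>
      intro E hE
      rw [← Algebra.smul_def]
      exact Submodule.smul_mem _ r hE
    | add x y hx' hy' hx hy =>
      intro E hE
      rw [add_mul]
      exact add_mem (hx hx' E hE) (hy hy' E hE)
    | mul x y hx' hy' hx hy =>
      intro E hE
      rw [mul_assoc]
      exact hx hx' _ (hy hy' E hE)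
  · rw [Submodule.span_le]
    rintro _ ⟨a, rfl⟩
    suffices ∀ b : ι →₀ ℕ, monomialDeriv k b ∈ diffAlg ι k →
        monomialDeriv k (b + a) ∈ diffAlg ι k by
      simpa using this 0 (by rw [monomialDeriv_zero]; exact one_mem _)
    induction a using Finsupp.induction_linear with
    | zero => simp
    | add a a' ha ha' =>
      intro b hb
      rw [← add_assoc]
      exact ha' _ (ha b hb)
    | single s n =>
      intro b hb
      induction n with
      | zero => simpa using hb
      | succ n ih =>
        have h : monomialDeriv k (b + Finsupp.single s (n + 1))
            = (pderiv s : Derivation k (MvPolynomial ι k) _).toLinearMap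
              * monomialDeriv k (b + Finsupp.single s n) := by
          refine LinearMap.ext fun f => ?_
          rw [Finsupp.single_add, ← add_assoc]
          exact (pderiv_monomialDeriv _ s f).symm
        rw [h]
        exact mul_mem (Algebra.subset_adjoin ⟨s, rfl⟩) ih

theorem orbit_diffAlg_eq_span (v : MvPolynomial ι k) :
    orbit (diffAlg ι k) v = Submodule.span k (Set.range fun a => monomialDeriv k a v) := by
  rw [orbit, diffAlg_eq_span, Submodule.map_span, ← Set.range_comp]
  rfl

end monomialDeriv

/-- Only exponents dividing some monomial of `v` give a nonzero derivative. Finiteness matters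
because `Module.finrank` is `0` on infinite-dimensional spaces, so its monotonicity needs it. -/
theorem finite_orbit_diffAlg {ι k : Type*} [Fintype ι] [CommRing k] (v : MvPolynomial ι k) :
    Module.Finite k (orbit (diffAlg ι k) v) := by
  classical
  rw [orbit_diffAlg_eq_span]
  have hfin : (Set.range fun a => monomialDeriv k a v).Finite := by
    refine ((v.support.finite_toSet.biUnion fun m _ =>
      (Set.finite_Iic m).image fun a => monomialDeriv k a v).insert 0).subset ?_
    rintro _ ⟨a, rfl⟩
    by_cases ha : ∃ m ∈ v.support, a ≤ m
    · obtain ⟨m, hm, ham⟩ := ha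
      exact Set.mem_insert_of_mem _ (Set.mem_biUnion (Finset.mem_coe.2 hm) ⟨a, ham, rfl⟩)
    · refine Set.mem_insert_iff.2 (Or.inl ?_)
      push Not at ha
      change monomialDeriv k a v = 0
      rw [v.as_sum, map_sum]
      refine Finset.sum_eq_zero fun m hm => ?_
      obtain ⟨s, hs⟩ : ∃ s, m s < a s := by
        by_contra! hle
        exact ha m hm hle
      rw [monomialDeriv_monomial,
        Finset.prod_eq_zero (f := fun s => (m s).descFactorial (a s)) (Finset.mem_univ s)
          (Nat.descFactorial_of_lt hs)]
      simp
  have := hfin.to_subtype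
  exact Module.Finite.span_of_finite k hfin

/-! ### Comparison of dimensions across characteristics. -/

/-- A finite linearly independent family of polynomials has a nonvanishing maximal minor. -/
theorem exists_det_coeff_ne_zero {σ k κ : Type*} [Field k] [Fintype κ] [DecidableEq κ]
    {w : κ → MvPolynomial σ k} (hw : LinearIndependent k w) :
    ∃ a : κ → σ →₀ ℕ, (Matrix.of fun i j => coeff (a j) (w i)).det ≠ 0 := by
  obtain ⟨κ', a, -, hspan, hli⟩ :=
    exists_linearIndependent' k fun (m : σ →₀ ℕ) (i : κ) => coeff m (w i)
  have htop : Submodule.span k (Set.range fun (m : σ →₀ ℕ) (i : κ) => coeff m (w i)) = ⊤ := by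
    -- A nonzero functional killing every coefficient vector would be a linear relation among the `w
    -- i`.
    by_contra hne
    obtain ⟨f, hf, hle⟩ := Submodule.exists_le_ker_of_lt_top _ (lt_top_iff_ne_top.2 hne)
    apply hf
    refine LinearMap.pi_ext' fun i => LinearMap.ext_ring ?_
    refine Fintype.linearIndependent_iff.1 hw (fun i => f (Pi.single i 1)) ?_ i
    ext m
    have hm : f (fun i => coeff m (w i)) = 0 := hle (Submodule.subset_span ⟨m, rfl⟩)
    rw [pi_eq_sum_univ' (fun i => coeff m (w i)), map_sum] at hm
    simp only [map_smul, smul_eq_mul] at hm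
    simp only [coeff_sum, coeff_smul, smul_eq_mul, coeff_zero]
    rw [← hm]
    refine Finset.sum_congr rfl fun i _ => ?_
    rw [mul_comm]
  let b := Module.Basis.mk hli (by rw [hspan, htop])
  have : Finite κ' := Module.Finite.finite_basis b
  have : Fintype κ' := Fintype.ofFinite κ'
  have hcard : Fintype.card κ = Fintype.card κ' := by
    rw [← Module.finrank_eq_card_basis b, Module.finrank_fintype_fun_eq_card]
  let e := Fintype.equivOfCardEq hcard
  refine ⟨a ∘ e, ?_⟩
  rw [← isUnit_iff_ne_zero, ← Matrix.isUnit_iff_isUnit_det,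
    ← Matrix.linearIndependent_cols_iff_isUnit]
  exact hli.comp e e.injective

/-- Integral polynomials that are linearly independent over some field are linearly independent
over every field of characteristic zero. -/
theorem linearIndependent_map_of_charZero {σ k K κ : Type*} [Field k] [Field K] [CharZero K]
    [Finite κ] {w : κ → MvPolynomial σ ℤ}
    (hw : LinearIndependent k fun i => map (Int.castRingHom k) (w i)) :
    LinearIndependent K fun i => map (Int.castRingHom K) (w i) := by
  classical
  have := Fintype.ofFinite κ
  obtain ⟨a, ha⟩ := exists_det_coeff_ne_zero hw
  -- The minor is the image of an integer. Being nonzero in `k`, that integer is nonzero, hence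
  -- nonzero in `K`.
  let A : Matrix κ κ ℤ := Matrix.of fun i j => coeff (a j) (w i)
  have hA : A.det ≠ 0 := by
    intro h
    apply ha
    rw [← map_zero (Int.castRingHom k), ← h, RingHom.map_det]
    congr 1
  have hK : IsUnit (A.map (Int.castRingHom K)) := by
    rw [Matrix.isUnit_iff_isUnit_det, isUnit_iff_ne_zero, ← RingHom.mapMatrix_apply,
      ← RingHom.map_det]
    simpa using hA
  refine LinearIndependent.of_comp (LinearMap.pi fun j => lcoeff K (a j)) ?_
  rw [← Matrix.linearIndependent_rows_iff_isUnit] at hK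
  have h : (LinearMap.pi fun j => lcoeff K (a j)) ∘ (fun i => map (Int.castRingHom K) (w i))
      = (A.map (Int.castRingHom K)).row := by
    ext i j
    simp [A, lcoeff, coeff_map, Matrix.row]
  rw [h]
  exact hK

/-- A basis over `k` can be chosen among the derivatives `∂^a f`, and these lift to integral
polynomials. -/
theorem finrank_orbit_map_le_of_charZero {ι k K : Type*} [Fintype ι] [Field k] [Field K]
    [CharZero K] (f : MvPolynomial ι ℤ) :
    Module.finrank k (orbit (diffAlg ι k) (map (Int.castRingHom k) f))
      ≤ Module.finrank K (orbit (diffAlg ι K) (map (Int.castRingHom K) f)) := by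
  obtain ⟨κ, a, -, hspan, hli⟩ :=
    exists_linearIndependent' k fun a : ι →₀ ℕ => monomialDeriv k a (map (Int.castRingHom k) f)
  have hfin := finite_orbit_diffAlg (map (Int.castRingHom k) f)
  have hfinK := finite_orbit_diffAlg (map (Int.castRingHom K) f)
  rw [orbit_diffAlg_eq_span, ← hspan] at hfin ⊢
  have : Finite κ := Module.Finite.finite_basis (Module.Basis.span hli)
  have := Fintype.ofFinite κ
  rw [finrank_span_eq_card hli]
  have hli' := linearIndependent_map_of_charZero (K := K)
    (w := fun i => monomialDeriv ℤ (a i) f) (by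
      simp only [← monomialDeriv_map]
      exact hli)
  simp only [← monomialDeriv_map] at hli'
  rw [← finrank_span_eq_card hli']
  refine Submodule.finrank_mono ?_
  rw [orbit_diffAlg_eq_span]
  exact Submodule.span_mono (Set.range_comp_subset_range a
    fun a => monomialDeriv K a (map (Int.castRingHom K) f))

/-! ### The lower bound for the Vandermonde determinant. -/

/-- The derivatives `∂^a f` for `a` dividing the leading monomial of `f` are linearly
independent. -/
theorem linearIndependent_monomialDeriv {ι K : Type*} [Fintype ι] [Field K] [CharZero K]
    (m : MonomialOrder ι) {f : MvPolynomial ι K} (hf : f ≠ 0) :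
    LinearIndependent K fun a : Set.Iic (m.degree f) => monomialDeriv K (a : ι →₀ ℕ) f := by
  classical
  rw [linearIndependent_iff']
  intro s c hc i hi
  generalize hx : m.toSyn (i : ι →₀ ℕ) = x
  induction x using WellFoundedLT.induction generalizing i with
  | ind x ih =>
    subst hx
    -- The system is triangular: at this exponent a term `j` above `i` contributes nothing, since `b
    -- + j` exceeds the leading exponent, and the coefficients of terms below `i` vanish by
    -- induction.
    set b : ι →₀ ℕ := m.degree f - i with hb
    have hbi : b + i = m.degree f := tsub_add_cancel_of_le i.2
    have h := congr_arg (coeff b) hc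
    rw [coeff_sum, coeff_zero, Finset.sum_eq_single_of_mem i hi] at h
    · rw [coeff_smul, smul_eq_mul] at h
      refine (mul_eq_zero.1 h).resolve_right fun h0 => ?_
      have h1 := prod_factorial_mul_coeff_monomialDeriv (i : ι →₀ ℕ) b f
      rw [h0, mul_zero, hbi, eq_comm, mul_eq_zero] at h1
      refine h1.elim (fun h2 => ?_) (m.coeff_degree_ne_zero_iff.2 hf)
      rw [Nat.cast_eq_zero, Finset.prod_eq_zero_iff] at h2
      obtain ⟨t, -, ht⟩ := h2
      exact Nat.factorial_ne_zero _ ht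
    · intro j hj hji
      rw [coeff_smul, smul_eq_mul]
      rcases lt_trichotomy (m.toSyn (j : ι →₀ ℕ)) (m.toSyn (i : ι →₀ ℕ)) with hlt | heq | hgt
      · rw [ih _ hlt j hj rfl, zero_mul]
      · exact absurd (Subtype.ext (m.toSyn.injective heq)) hji
      · have h1 := prod_factorial_mul_coeff_monomialDeriv (j : ι →₀ ℕ) b f
        rw [m.coeff_eq_zero_of_lt (d := b + j), mul_zero, mul_eq_zero] at h1
        · rw [h1.resolve_left, mul_zero]
          rw [Nat.cast_eq_zero, Finset.prod_eq_zero_iff]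
          rintro ⟨t, -, ht⟩
          exact Nat.factorial_ne_zero _ ht
        · calc m.toSyn (m.degree f) = m.toSyn b + m.toSyn (i : ι →₀ ℕ) := by
                rw [← map_add, hbi]
            _ < m.toSyn (b + j) := by
                rw [map_add]
                exact add_lt_add_right hgt _

theorem degree_X_sub_X {n : ℕ} {K : Type*} [Field K] {s t : Fin n} (h : s < t) :
    MonomialOrder.lex.degree (X s - X t : MvPolynomial (Fin n) K) = Finsupp.single s 1 := by
  have hlt : MonomialOrder.lex.toSyn (MonomialOrder.lex.degree (X t : MvPolynomial (Fin n) K))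
      < MonomialOrder.lex.toSyn (MonomialOrder.lex.degree (X s : MvPolynomial (Fin n) K)) := by
    rw [MonomialOrder.degree_X, MonomialOrder.degree_X, MonomialOrder.lex_lt_iff]
    exact Finsupp.Lex.single_lt_iff.2 h
  rw [MonomialOrder.degree_sub_of_lt hlt, MonomialOrder.degree_X]

theorem vandermonde_ne_zero (n : ℕ) (K : Type*) [Field K] : vandermonde n K ≠ 0 :=
  Finset.prod_ne_zero_iff.2 fun _ _ => Finset.prod_ne_zero_iff.2 fun _ ht =>
    sub_ne_zero.2 fun h => (Finset.mem_Ioi.1 ht).ne (X_injective h)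

theorem degree_vandermonde (n : ℕ) (K : Type*) [Field K] (s : Fin n) :
    MonomialOrder.lex.degree (vandermonde n K) s = n - 1 - s := by
  rw [vandermonde, MonomialOrder.degree_prod]
  · have h : ∀ i : Fin n, MonomialOrder.lex.degree
        (∏ t ∈ Finset.Ioi i, (X i - X t : MvPolynomial (Fin n) K))
          = Finsupp.single i (n - 1 - i : ℕ) := by
      intro i
      rw [MonomialOrder.degree_prod]
      · rw [Finset.sum_congr rfl fun t ht => degree_X_sub_X (Finset.mem_Ioi.1 ht)]
        rw [Finset.sum_const, Fin.card_Ioi, Finsupp.smul_single, smul_eq_mul, mul_one]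
      · exact fun t ht => sub_ne_zero.2 fun h => (Finset.mem_Ioi.1 ht).ne (X_injective h)
    simp only [h, Finsupp.finsetSum_apply, Finsupp.single_apply]
    simp
  · exact fun i _ => Finset.prod_ne_zero_iff.2 fun _ ht =>
      sub_ne_zero.2 fun h => (Finset.mem_Ioi.1 ht).ne (X_injective h)

/-- The lexicographic leading exponent is `(n - 1, …, 1, 0)`, which has `n * ⋯ * 2 * 1` divisors. -/
theorem factorial_le_finrank_orbit_vandermonde (n : ℕ) (K : Type*) [Field K] [CharZero K] :
    n ! ≤ Module.finrank K (orbit (diffAlg (Fin n) K) (vandermonde n K)) := by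
  have hli := linearIndependent_monomialDeriv (MonomialOrder.lex (σ := Fin n))
    (vandermonde_ne_zero n K)
  have hfin := finite_orbit_diffAlg (vandermonde n K)
  set d := MonomialOrder.lex.degree (vandermonde n K) with hd
  have hcard : Fintype.card (Set.Iic d) = n ! := by
    rw [Fintype.card_of_finset' (Finset.Iic d) (by simp), Finsupp.card_Iic]
    have h : ∀ s : Fin n, (Finset.Iic (d s)).card = n - 1 - s + 1 := fun s => by
      rw [hd, degree_vandermonde, Nat.card_Iic]
    rw [Finset.prod_subset (Finset.subset_univ _) fun s _ hs => by
      rw [Finsupp.notMem_support_iff.1 hs]; rfl]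
    simp only [h]
    rw [Fin.prod_univ_eq_prod_range (fun s => n - 1 - s + 1) n,
      Finset.prod_range_reflect (fun s => s + 1) n, Finset.prod_range_add_one_eq_factorial]
  rw [← hcard, ← finrank_span_eq_card hli]
  refine Submodule.finrank_mono ?_
  rw [orbit_diffAlg_eq_span]
  refine Submodule.span_mono ?_
  rintro _ ⟨a, rfl⟩
  exact ⟨a, rfl⟩

/-! ### The box diagram and the monomials of `Δ`. -/

theorem part_box (p j : ℕ) : part (box p) j = if j < p then p else 0 := by
  have h : (box p).parts.sort (· ≥ ·) = List.replicate p p := by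
    rw [← List.perm_replicate, ← Multiset.coe_eq_coe, Multiset.sort_eq]
    rfl
  rw [part, h, List.getD_eq_getElem?_getD, List.getElem?_replicate]
  split_ifs <;> rfl

theorem mem_diagram_box {p : ℕ} {c : ℕ × ℕ} : c ∈ diagram (box p) ↔ c.1 < p ∧ c.2 < p := by
  change c.1 < part (box p) c.2 ↔ _
  rw [part_box]
  split_ifs with h <;> simp [h]

/-- The exponent of `∏ s, X_s ^ (u s).1 * Y_s ^ (u s).2`. -/
def pairExponent {n : ℕ} (u : Fin n → ℕ × ℕ) : Fin n ⊕ Fin n →₀ ℕ :=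
  Finsupp.equivFunOnFinite.symm (Sum.elim (fun s => (u s).1) fun s => (u s).2)

@[simp]
theorem pairExponent_inl {n : ℕ} (u : Fin n → ℕ × ℕ) (s : Fin n) :
    pairExponent u (Sum.inl s) = (u s).1 := rfl

@[simp]
theorem pairExponent_inr {n : ℕ} (u : Fin n → ℕ × ℕ) (s : Fin n) :
    pairExponent u (Sum.inr s) = (u s).2 := rfl

theorem pairExponent_injective {n : ℕ} :
    Function.Injective (pairExponent : (Fin n → ℕ × ℕ) → Fin n ⊕ Fin n →₀ ℕ) := fun _ _ h =>
  funext fun s => Prod.ext (DFunLike.congr_fun h (Sum.inl s)) (DFunLike.congr_fun h (Sum.inr s))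

theorem monomial_pairExponent {n : ℕ} {k : Type*} [CommRing k] (u : Fin n → ℕ × ℕ) :
    (monomial (pairExponent u) 1 : MvPolynomial (Fin n ⊕ Fin n) k)
      = ∏ s, (X (Sum.inl s) ^ (u s).1 * X (Sum.inr s) ^ (u s).2) := by
  rw [monomial_eq, C_1, one_mul, Finsupp.prod_fintype _ _ fun _ => pow_zero _,
    Fintype.prod_sum_type, Finset.prod_mul_distrib]
  rfl

theorem det_pow_mul_pow_eq_sum {n : ℕ} {k : Type*} [CommRing k] (u : Fin n → ℕ × ℕ) :
    (Matrix.of fun s t : Fin n => (X (Sum.inl s) ^ (u t).1 * X (Sum.inr s) ^ (u t).2 :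
      MvPolynomial (Fin n ⊕ Fin n) k)).det
      = ∑ τ : Equiv.Perm (Fin n), ((Equiv.Perm.sign τ : ℤ) : k) •
          monomial (pairExponent (u ∘ τ)) 1 := by
  rw [← Matrix.det_transpose, Matrix.det_apply']
  refine Finset.sum_congr rfl fun τ _ => ?_
  rw [monomial_pairExponent, smul_eq_C_mul, map_intCast]
  rfl

section coeff

variable {n : ℕ} {σ : n.Partition} {e : Fin n ≃ diagram σ} {k : Type*} [CommRing k]

theorem deltaPoly_eq_sum :
    deltaPoly σ e k = ∑ τ : Equiv.Perm (Fin n), ((Equiv.Perm.sign τ : ℤ) : k) •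
      monomial (pairExponent fun s => (e (τ s)).1) 1 :=
  det_pow_mul_pow_eq_sum fun t => (e t).1

theorem coeff_deltaPoly (b : Fin n ⊕ Fin n →₀ ℕ) :
    coeff b (deltaPoly σ e k) = ∑ τ : Equiv.Perm (Fin n),
      if pairExponent (fun s => (e (τ s)).1) = b then ((Equiv.Perm.sign τ : ℤ) : k) else 0 := by
  rw [deltaPoly_eq_sum, coeff_sum]
  refine Finset.sum_congr rfl fun τ _ => ?_
  rw [coeff_smul, coeff_monomial]
  simp

theorem exists_pairExponent_eq_of_coeff_deltaPoly_ne_zero {b : Fin n ⊕ Fin n →₀ ℕ}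
    (hb : coeff b (deltaPoly σ e k) ≠ 0) :
    ∃ τ : Equiv.Perm (Fin n), pairExponent (fun s => (e (τ s)).1) = b := by
  rw [coeff_deltaPoly] at hb
  obtain ⟨τ, -, hτ⟩ := Finset.exists_ne_zero_of_sum_ne_zero hb
  exact ⟨τ, by by_contra h; exact hτ (if_neg h)⟩

theorem coeff_pairExponent_deltaPoly (τ : Equiv.Perm (Fin n)) :
    coeff (pairExponent fun s => (e (τ s)).1) (deltaPoly σ e k)
      = ((Equiv.Perm.sign τ : ℤ) : k) := by
  rw [coeff_deltaPoly, Finset.sum_eq_single_of_mem τ (Finset.mem_univ τ), if_pos rfl]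
  intro π _ hπ
  refine if_neg fun h => hπ (Equiv.ext fun s => ?_)
  exact e.injective (Subtype.ext (congr_fun (pairExponent_injective h) s))

theorem sum_eq_of_coeff_deltaPoly_ne_zero {b : Fin n ⊕ Fin n →₀ ℕ}
    (hb : coeff b (deltaPoly σ e k) ≠ 0) :
    ∑ x, b x = ∑ t, ((e t).1.1 + (e t).1.2) := by
  obtain ⟨τ, rfl⟩ := exists_pairExponent_eq_of_coeff_deltaPoly_ne_zero hb
  rw [Fintype.sum_sum_type, ← Finset.sum_add_distrib]
  exact Equiv.sum_comp τ fun t => (e t).1.1 + (e t).1.2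

/-- All monomials of `Δ` use the same pairs of exponents, permuted. The factorials produced by
differentiation therefore become a common constant. -/
theorem prod_factorial_eq_of_coeff_deltaPoly_ne_zero {b : Fin n ⊕ Fin n →₀ ℕ}
    (hb : coeff b (deltaPoly σ e k) ≠ 0) :
    ∏ x, (b x)! = ∏ t, ((e t).1.1 ! * (e t).1.2 !) := by
  obtain ⟨τ, rfl⟩ := exists_pairExponent_eq_of_coeff_deltaPoly_ne_zero hb
  rw [Fintype.prod_sum_type, ← Finset.prod_mul_distrib]
  exact Equiv.prod_comp τ fun t => (e t).1.1 ! * (e t).1.2 !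

end coeff

/-! ### The upper bound from an orbit of roots of unity. -/

section rootsOfUnity

variable {p n : ℕ} {K : Type*} [Field K]

/-- The value of the monomial with exponent `b` at the point whose `s`-th pair of coordinates is
`(ζ ^ (u s).1, ζ ^ (u s).2)`. -/
def rootEval (ζ : K) (u : Fin n → ℕ × ℕ) (b : Fin n ⊕ Fin n →₀ ℕ) : K :=
  ∏ s, ((ζ ^ (u s).1) ^ b (Sum.inl s) * (ζ ^ (u s).2) ^ b (Sum.inr s))

theorem rootEval_add (ζ : K) (u : Fin n → ℕ × ℕ) (a b : Fin n ⊕ Fin n →₀ ℕ) :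
    rootEval ζ u (a + b) = rootEval ζ u a * rootEval ζ u b := by
  rw [rootEval, rootEval, rootEval, ← Finset.prod_mul_distrib]
  refine Finset.prod_congr rfl fun s _ => ?_
  simp only [Finsupp.add_apply, pow_add]
  ring

/-- The matrix of values of the monomials `x^i y^j` at the points `(ζ^i', ζ^j')`. -/
def rootMatrix (ζ : K) (u : Fin n → ℕ × ℕ) : Matrix (Fin n) (Fin n) K :=
  Matrix.of fun s t => (ζ ^ (u t).1) ^ (u s).1 * (ζ ^ (u t).2) ^ (u s).2

/-- Up to reindexing and transposition this is the Kronecker square of the Vandermonde matrix of the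
distinct powers of `ζ`. -/
theorem det_rootMatrix_ne_zero {ζ : K} (hζ : IsPrimitiveRoot ζ p)
    (e : Fin (p ^ 2) ≃ diagram (box p)) :
    (rootMatrix ζ fun t => (e t).1).det ≠ 0 := by
  let g : Fin (p ^ 2) ≃ Fin p × Fin p := e.trans
    { toFun := fun c => (⟨c.1.1, (mem_diagram_box.1 c.2).1⟩, ⟨c.1.2, (mem_diagram_box.1 c.2).2⟩)
      invFun := fun c => ⟨(c.1, c.2), mem_diagram_box.2 ⟨c.1.2, c.2.2⟩⟩
      left_inv := fun _ => rfl
      right_inv := fun _ => rfl }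
  let V : Matrix (Fin p) (Fin p) K := Matrix.vandermonde fun i => ζ ^ (i : ℕ)
  have hV : V.det ≠ 0 := Matrix.det_vandermonde_ne_zero_iff.2 fun i j h =>
    Fin.ext (hζ.pow_inj i.2 j.2 h)
  have h : rootMatrix ζ (fun t => (e t).1)
      = ((Matrix.kroneckerMap (· * ·) V V).submatrix g g).transpose := rfl
  rw [h, Matrix.det_transpose, Matrix.det_submatrix_equiv_self, Matrix.det_kronecker]
  exact mul_ne_zero (pow_ne_zero _ hV) (pow_ne_zero _ hV)

end rootsOfUnity

section rootsOfUnity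

variable {p : ℕ} {K : Type*} [Field K]

/-- The alternating sum of the values of a monomial, of degree at most that of `Δ`, over the
orbit of the point whose coordinates are the pairs of `p`-th roots of unity. -/
theorem sum_sign_mul_rootEval (hp : 0 < p) {ζ : K} (hζ : ζ ^ p = 1)
    (e : Fin (p ^ 2) ≃ diagram (box p)) {b : Fin (p ^ 2) ⊕ Fin (p ^ 2) →₀ ℕ}
    (hb : ∑ x, b x ≤ ∑ t, ((e t).1.1 + (e t).1.2)) :
    ∑ τ : Equiv.Perm (Fin (p ^ 2)),
        ((Equiv.Perm.sign τ : ℤ) : K) * rootEval ζ (fun s => (e (τ s)).1) b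
      = (rootMatrix ζ fun t => (e t).1).det * coeff b (deltaPoly (box p) e K) := by
  let v : Fin (p ^ 2) → diagram (box p) := fun s =>
    ⟨(b (Sum.inl s) % p, b (Sum.inr s) % p),
      mem_diagram_box.2 ⟨Nat.mod_lt _ hp, Nat.mod_lt _ hp⟩⟩
  let f : Fin (p ^ 2) → Fin (p ^ 2) := fun s => e.symm (v s)
  have hef : ∀ s, (e (f s)).1 = (b (Sum.inl s) % p, b (Sum.inr s) % p) := fun s => by
    simp [f, v]
  have hpow : ∀ i j : ℕ, (ζ ^ i) ^ (j % p) = (ζ ^ i) ^ j := fun i j => by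
    have h : (ζ ^ i) ^ p = 1 := by rw [← pow_mul, mul_comm, pow_mul, hζ, one_pow]
    exact (pow_eq_pow_mod j h).symm
  -- On `p`-th roots of unity exponents matter only modulo `p`, so the sum is a determinant whose
  -- rows are rows of `rootMatrix`, possibly repeated.
  have hdet : ∑ τ : Equiv.Perm (Fin (p ^ 2)),
        ((Equiv.Perm.sign τ : ℤ) : K) * rootEval ζ (fun s => (e (τ s)).1) b
      = ((rootMatrix ζ fun t => (e t).1).submatrix f id).det := by
    rw [← Matrix.det_transpose, Matrix.det_apply']
    refine Finset.sum_congr rfl fun τ _ => ?_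
    congr 1
    refine Finset.prod_congr rfl fun s _ => ?_
    simp only [rootMatrix, Matrix.transpose_apply, Matrix.submatrix_apply, Matrix.of_apply, hef,
      hpow, id]
  rw [hdet]
  by_cases hf : Function.Injective f
  · let π : Equiv.Perm (Fin (p ^ 2)) := Equiv.ofBijective f (Finite.injective_iff_bijective.1 hf)
    have hπ : ∀ s, (e (π s)).1 = (b (Sum.inl s) % p, b (Sum.inr s) % p) := hef
    have hsum : ∑ x, b x ≤ ∑ x, pairExponent (fun s => (e (π s)).1) x := by
      refine hb.trans_eq ?_
      rw [Fintype.sum_sum_type, ← Finset.sum_add_distrib]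
      exact (Equiv.sum_comp π fun t => (e t).1.1 + (e t).1.2).symm
    -- Reduction modulo `p` only lowers exponents. The reduced exponent already has the degree of
    -- `Δ`, so the degree bound on `b` forces equality.
    have hle : ∀ x ∈ Finset.univ, pairExponent (fun s => (e (π s)).1) x ≤ b x := by
      rintro (s | s) - <;> simp [hπ, Nat.mod_le]
    have hbπ : pairExponent (fun s => (e (π s)).1) = b := Finsupp.ext fun x =>
      (Finset.sum_eq_sum_iff_of_le hle).1 (le_antisymm (Finset.sum_le_sum hle) hsum) x
        (Finset.mem_univ x)
    rw [← hbπ, coeff_pairExponent_deltaPoly, mul_comm]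
    exact Matrix.det_permute π _
  · have hf' := hf
    rw [Function.Injective] at hf'
    push Not at hf'
    obtain ⟨s, t, hst, hne⟩ := hf'
    rw [Matrix.det_zero_of_row_eq hne (funext fun i => by simp [hst])]
    -- The coefficient vanishes too: a monomial of `Δ` has exponents below `p` and distinct pairs,
    -- which would make `f` injective.
    rw [eq_comm, mul_eq_zero]
    refine Or.inr ?_
    by_contra hcoeff
    obtain ⟨τ, rfl⟩ := exists_pairExponent_eq_of_coeff_deltaPoly_ne_zero hcoeff
    refine hf fun s t hst => ?_
    have h : ∀ s, (e (f s)).1 = (e (τ s)).1 := fun s => by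
      rw [hef]
      have := mem_diagram_box.1 (e (τ s)).2
      simp [Nat.mod_eq_of_lt this.1, Nat.mod_eq_of_lt this.2]
    have h' := (h s).symm.trans ((congr_arg (fun i => (e i).1) hst).trans (h t))
    exact τ.injective (e.injective (Subtype.ext h'))

/-- Linear independence of derivatives of `Δ` forces linear independence of the corresponding
monomials as functions on the orbit of a point. -/
theorem linearIndependent_rootEval [CharZero K] (hp : 0 < p) {ζ : K} (hζ : IsPrimitiveRoot ζ p)
    (e : Fin (p ^ 2) ≃ diagram (box p)) {κ : Type*} {a : κ → Fin (p ^ 2) ⊕ Fin (p ^ 2) →₀ ℕ}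
    (ha : LinearIndependent K fun i => monomialDeriv K (a i) (deltaPoly (box p) e K)) :
    LinearIndependent K fun i (τ : Equiv.Perm (Fin (p ^ 2))) =>
      rootEval ζ (fun s => (e (τ s)).1) (a i) := by
  classical
  set Δ := deltaPoly (box p) e K with hΔ
  rw [linearIndependent_iff'] at ha ⊢
  intro S c hc
  by_contra! hne
  obtain ⟨i₁, hi₁, hci₁⟩ := hne
  -- It suffices to contradict the top-degree part of the relation: that part, applied to `Δ`, will
  -- be shown to vanish.
  obtain ⟨i₀, hi₀, hmax⟩ := Finset.exists_max_image (S.filter fun i => c i ≠ 0)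
    (fun i => ∑ x, a i x) ⟨i₁, Finset.mem_filter.2 ⟨hi₁, hci₁⟩⟩
  rw [Finset.mem_filter] at hi₀
  set d := ∑ x, a i₀ x with hd
  refine hi₀.2 ?_
  suffices h : ∑ i ∈ S, (if ∑ x, a i x = d then c i else 0) • monomialDeriv K (a i) Δ = 0 by
    simpa [hd] using ha S _ h i₀ hi₀.1
  ext m
  have hfact : ∀ m : Fin (p ^ 2) ⊕ Fin (p ^ 2) →₀ ℕ, ((∏ x, (m x)! : ℕ) : K) ≠ 0 := fun m =>
    Nat.cast_ne_zero.2 (Finset.prod_ne_zero_iff.2 fun x _ => Nat.factorial_ne_zero _)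
  refine (mul_eq_zero.1 (?_ : ((∏ x, (m x)! : ℕ) : K) * _ = 0)).resolve_left (hfact m)
  set N := ∑ t, ((e t).1.1 + (e t).1.2) with hN
  set L := ∏ t, ((e t).1.1 ! * (e t).1.2 !) with hL
  have hterm : ∀ i ∈ S, ((∏ x, (m x)! : ℕ) : K) * coeff m
      ((if ∑ x, a i x = d then c i else 0) • monomialDeriv K (a i) Δ)
      = L * ((if ∑ x, a i x = d then c i else 0) * coeff (m + a i) Δ) := by
    intro i _
    rw [coeff_smul, smul_eq_mul, mul_left_comm, prod_factorial_mul_coeff_monomialDeriv]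
    by_cases h0 : coeff (m + a i) Δ = 0
    · simp [h0]
    · rw [prod_factorial_eq_of_coeff_deltaPoly_ne_zero h0]
      ring
  rw [coeff_sum, Finset.mul_sum, Finset.sum_congr rfl hterm, ← Finset.mul_sum]
  refine mul_eq_zero_of_right _ ?_
  by_cases hmd : ∑ x, m x + d = N
  · have hM := det_rootMatrix_ne_zero hζ e
    refine (mul_eq_zero.1 (?_ : (rootMatrix ζ fun t => (e t).1).det * _ = 0)).resolve_left hM
    have hterm' : ∀ i ∈ S, (rootMatrix ζ fun t => (e t).1).det
          * ((if ∑ x, a i x = d then c i else 0) * coeff (m + a i) Δ)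
        = ∑ τ : Equiv.Perm (Fin (p ^ 2)), (((Equiv.Perm.sign τ : ℤ) : K)
            * rootEval ζ (fun s => (e (τ s)).1) m)
            * (c i * rootEval ζ (fun s => (e (τ s)).1) (a i)) := by
      intro i hi
      by_cases hci : c i = 0
      · simp [hci]
      have hle : ∑ x, a i x ≤ d := hmax i (Finset.mem_filter.2 ⟨hi, hci⟩)
      have hsum : ∑ x, (m + a i) x = ∑ x, m x + ∑ x, a i x := by
        simp [Finset.sum_add_distrib]
      -- Terms of degree below `d` may be readmitted: `m + a i` then falls short of the degree `N`
      -- of `Δ`. This restores the full relation `hc`.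
      have h1 : (if ∑ x, a i x = d then c i else 0) * coeff (m + a i) Δ
          = c i * coeff (m + a i) Δ := by
        split_ifs with h
        · rfl
        · have h0 : coeff (m + a i) Δ = 0 := by
            by_contra h0
            have := sum_eq_of_coeff_deltaPoly_ne_zero h0
            omega
          simp [h0]
      rw [h1, mul_left_comm, ← sum_sign_mul_rootEval hp hζ.pow_eq_one e (by omega),
        Finset.mul_sum]
      refine Finset.sum_congr rfl fun τ _ => ?_
      rw [rootEval_add]
      ring
    rw [Finset.mul_sum, Finset.sum_congr rfl hterm', Finset.sum_comm]
    refine Finset.sum_eq_zero fun τ _ => ?_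
    rw [← Finset.mul_sum]
    refine mul_eq_zero_of_right _ ?_
    simpa using congr_fun hc τ
  · refine Finset.sum_eq_zero fun i _ => ?_
    split_ifs with h
    · refine mul_eq_zero_of_right _ ?_
      by_contra h0
      have := sum_eq_of_coeff_deltaPoly_ne_zero h0
      have hsum : ∑ x, (m + a i) x = ∑ x, m x + ∑ x, a i x := by
        simp [Finset.sum_add_distrib]
      omega
    · exact zero_mul _

/-- Functions on the permutations form a space of dimension `(p ^ 2)!`. -/
theorem finrank_orbit_deltaPoly_box_le [CharZero K] (hp : 0 < p) {ζ : K}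
    (hζ : IsPrimitiveRoot ζ p) (e : Fin (p ^ 2) ≃ diagram (box p)) :
    Module.finrank K (orbit (diffAlg (Fin (p ^ 2) ⊕ Fin (p ^ 2)) K) (deltaPoly (box p) e K))
      ≤ (p ^ 2)! := by
  obtain ⟨κ, a, -, hspan, hli⟩ := exists_linearIndependent' K
    fun a : Fin (p ^ 2) ⊕ Fin (p ^ 2) →₀ ℕ => monomialDeriv K a (deltaPoly (box p) e K)
  have hli' := linearIndependent_rootEval hp hζ e hli
  have : Finite κ := hli'.finite
  have := Fintype.ofFinite κ
  rw [orbit_diffAlg_eq_span, ← hspan, finrank_span_eq_card hli]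
  refine hli'.fintype_card_le_finrank.trans_eq ?_
  rw [Module.finrank_fintype_fun_eq_card, Fintype.card_perm, Fintype.card_fin]

end rootsOfUnity

/-! ### Base `p` digits and divided operators. -/

theorem orbit_smul_of_ne_zero {k M : Type*} [Field k] [AddCommGroup M] [Module k M]
    (A : Subalgebra k (Module.End k M)) {c : k} (hc : c ≠ 0) (v : M) :
    orbit A (c • v) = orbit A v := by
  ext w
  rw [mem_orbit, mem_orbit]
  constructor
  · rintro ⟨D, hD, rfl⟩
    exact ⟨c • D, A.smul_mem hD c, by simp⟩
  · rintro ⟨D, hD, rfl⟩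
    exact ⟨c⁻¹ • D, A.smul_mem hD c⁻¹, by simp [hc]⟩

section dividedDeriv

variable {ι k : Type*}

theorem dividedDeriv_mem_restrictDegree [CommRing k] (s : ι) (m N : ℕ) {f : MvPolynomial ι k}
    (hf : f ∈ restrictDegree ι k N) : dividedDeriv k s m f ∈ restrictDegree ι k N := by
  classical
  rw [mem_restrictDegree] at hf
  rw [f.as_sum, map_sum]
  refine Submodule.sum_mem _ fun a ha => ?_
  rw [dividedDeriv_monomial, mem_restrictDegree]
  intro b hb i
  rw [Finset.mem_singleton.1 (support_monomial_subset hb)]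
  exact (Nat.sub_le _ _).trans (hf a ha i)

theorem dividedDeriv_eq_zero_of_mem_restrictDegree [CommRing k] (s : ι) {m N : ℕ} (h : N < m)
    {f : MvPolynomial ι k} (hf : f ∈ restrictDegree ι k N) : dividedDeriv k s m f = 0 := by
  rw [mem_restrictDegree] at hf
  rw [f.as_sum, map_sum]
  refine Finset.sum_eq_zero fun a ha => ?_
  rw [dividedDeriv_monomial, Nat.choose_eq_zero_of_lt ((hf a ha s).trans_lt h)]
  simp

theorem dividedDeriv_mem_diffAlg [Field k] {p : ℕ} (hp : p.Prime) [CharP k p] (s : ι) {m : ℕ}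
    (hm : m < p) : dividedDeriv k s m ∈ diffAlg ι k := by
  have hm0 : (m ! : k) ≠ 0 := fun h =>
    hm.not_ge ((hp.dvd_factorial).1 ((CharP.cast_eq_zero_iff k p _).1 h))
  have h : dividedDeriv k s m = (m ! : k)⁻¹ •
      (pderiv s : Derivation k (MvPolynomial ι k) _).toLinearMap ^ m := by
    refine LinearMap.ext fun f => ?_
    rw [LinearMap.smul_apply, Module.End.pow_apply]
    have := factorial_smul_dividedDeriv (k := k) s m f
    exact (inv_smul_eq_iff₀ hm0).2 this.symm |>.symm
  rw [h]
  exact Subalgebra.smul_mem _ (pow_mem (Algebra.subset_adjoin (Set.mem_range_self s)) m) _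

theorem dividedDeriv_one [CommRing k] (s : ι) :
    dividedDeriv k s 1 = (pderiv s : Derivation k (MvPolynomial ι k) _).toLinearMap := by
  refine LinearMap.ext fun f => ?_
  simpa using factorial_smul_dividedDeriv (k := k) s 1 f

theorem dividedDeriv_zero [CommRing k] (s : ι) : dividedDeriv k s 0 = LinearMap.id := by
  refine LinearMap.ext fun f => ?_
  simpa using factorial_smul_dividedDeriv (k := k) s 0 f

end dividedDeriv

/-- The linear map `∏ X_s ^ (i_s + p j_s) ↦ ∏ X_s ^ i_s Y_s ^ j_s`, for `i_s < p`. -/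
def digitMap (p n : ℕ) (k : Type*) [CommRing k] :
    MvPolynomial (Fin n) k →ₗ[k] MvPolynomial (Fin n ⊕ Fin n) k :=
  (basisMonomials (Fin n) k).constr k fun a =>
    monomial (pairExponent fun s => (a s % p, a s / p)) 1

section digitMap

variable {p n : ℕ} {k : Type*}

theorem digitMap_monomial [CommRing k] (a : Fin n →₀ ℕ) (c : k) :
    digitMap p n k (monomial a c) = monomial (pairExponent fun s => (a s % p, a s / p)) c := by
  have h : monomial a c = c • basisMonomials (Fin n) k a := by
    simp [smul_monomial]
  rw [h, map_smul, digitMap, Module.Basis.constr_basis, smul_monomial, smul_eq_mul, mul_one]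

theorem digitMap_injective [CommRing k] : Function.Injective (digitMap p n k) := by
  have hinj : Function.Injective fun a : Fin n →₀ ℕ =>
      pairExponent fun s => (a s % p, a s / p) := fun a b h => Finsupp.ext fun s => by
    have hs := Prod.ext_iff.1 (congr_fun (pairExponent_injective h) s)
    have h1 : a s % p = b s % p := hs.1
    have h2 : a s / p = b s / p := hs.2
    rw [← Nat.mod_add_div (a s) p, ← Nat.mod_add_div (b s) p, h1, h2]
  have hcoeff : ∀ (f : MvPolynomial (Fin n) k) (a : Fin n →₀ ℕ),
      coeff (pairExponent fun s => (a s % p, a s / p)) (digitMap p n k f) = coeff a f := by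
    classical
    intro f a
    induction f using MvPolynomial.induction_on' with
    | monomial b c =>
      rw [digitMap_monomial, coeff_monomial, coeff_monomial]
      exact if_congr hinj.eq_iff rfl rfl
    | add f g hf hg => simp only [map_add, coeff_add, hf, hg]
  intro f g h
  ext a
  rw [← hcoeff, h, hcoeff]

/-- Lucas' theorem, in terms of operators. -/
theorem digitMap_dividedDeriv [Field k] (hp : p.Prime) [CharP k p] (s : Fin n) (m : ℕ)
    (f : MvPolynomial (Fin n) k) :
    digitMap p n k (dividedDeriv k s m f)
      = dividedDeriv k (Sum.inl s) (m % p)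
          (dividedDeriv k (Sum.inr s) (m / p) (digitMap p n k f)) := by
  classical
  have : Fact p.Prime := ⟨hp⟩
  induction f using MvPolynomial.induction_on' with
  | monomial a c =>
    have hcoeff : ((a s).choose m : k)
        = ((a s % p).choose (m % p) : k) * ((a s / p).choose (m / p) : k) := by
      rw [← Nat.cast_mul]
      exact (CharP.natCast_eq_natCast k p).2 Choose.choose_modEq_choose_mod_mul_choose_div_nat
    simp only [dividedDeriv_monomial, digitMap_monomial]
    have h1 : ((pairExponent fun s => (a s % p, a s / p)) - Finsupp.single (Sum.inr s) (m / p) :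
        Fin n ⊕ Fin n →₀ ℕ) (Sum.inl s) = a s % p := by
      simp
    rw [h1, pairExponent_inr, hcoeff, mul_assoc]
    by_cases hlt : a s % p < m % p ∨ a s / p < m / p
    · rcases hlt with h | h <;> simp [Nat.choose_eq_zero_of_lt h]
    · push Not at hlt
      -- Both digits of `m` are at most those of `a s`, so subtraction involves no borrowing.
      have h2 : (a s - m) = (a s % p - m % p) + p * (a s / p - m / p) := by
        conv_lhs => rw [← Nat.mod_add_div (a s) p, ← Nat.mod_add_div m p]
        obtain ⟨x, hx⟩ := Nat.exists_eq_add_of_le hlt.1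
        obtain ⟨y, hy⟩ := Nat.exists_eq_add_of_le hlt.2
        rw [hx, hy, mul_add, add_tsub_cancel_left, add_tsub_cancel_left]
        omega
      have h3 : a s % p - m % p < p := (Nat.sub_le _ _).trans_lt (Nat.mod_lt _ hp.pos)
      refine congr_arg (fun b => monomial b _) (Finsupp.ext ?_)
      rintro (t | t)
      · by_cases hts : s = t
        · subst hts
          simp [h2, Nat.mod_eq_of_lt h3, Finsupp.single_apply]
        · simp [Finsupp.single_apply, hts]
      · by_cases hts : s = t
        · subst hts
          simp [h2, Nat.add_mul_div_left _ _ hp.pos, Nat.div_eq_of_lt h3, Finsupp.single_apply]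
        · simp [Finsupp.single_apply, hts]
  | add f g hf hg => simp only [map_add, hf, hg]

/-- The degree bound disposes of orders `m ≥ p ^ 2`, whose upper part `m / p` is not below `p`: such
operators vanish here. Stability of the bounded space is carried along so that products can be
handled. -/
theorem exists_diffAlg_digitMap_eq [Field k] (hp : p.Prime) [CharP k p]
    {D : Module.End k (MvPolynomial (Fin n) k)} (hD : D ∈ dividedDiffAlg (Fin n) k) :
    (∀ g ∈ restrictDegree (Fin n) k (p ^ 2 - 1), D g ∈ restrictDegree (Fin n) k (p ^ 2 - 1)) ∧
      ∃ E ∈ diffAlg (Fin n ⊕ Fin n) k, ∀ g ∈ restrictDegree (Fin n) k (p ^ 2 - 1),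
        digitMap p n k (D g) = E (digitMap p n k g) := by
  have hlt : p ^ 2 - 1 < p ^ 2 := Nat.sub_lt (pow_pos hp.pos 2) one_pos
  generalize p ^ 2 - 1 = N at hlt ⊢
  induction hD using Algebra.adjoin_induction with
  | mem D hD =>
    obtain ⟨⟨s, m⟩, rfl⟩ := hD
    refine ⟨fun g => dividedDeriv_mem_restrictDegree s m N, ?_⟩
    by_cases hm : m < p ^ 2
    · have hmp : m / p < p := Nat.div_lt_of_lt_mul (by rwa [← pow_two])
      exact ⟨dividedDeriv k (Sum.inl s) (m % p) * dividedDeriv k (Sum.inr s) (m / p),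
        mul_mem (dividedDeriv_mem_diffAlg hp _ (Nat.mod_lt m hp.pos))
          (dividedDeriv_mem_diffAlg hp _ hmp),
        fun g _ => digitMap_dividedDeriv hp s m g⟩
    · refine ⟨0, zero_mem _, fun g hg => ?_⟩
      have h := dividedDeriv_eq_zero_of_mem_restrictDegree s (hlt.trans_le (not_lt.1 hm)) hg
      rw [h, map_zero, LinearMap.zero_apply]
  | algebraMap r =>
    exact ⟨fun g hg => Submodule.smul_mem _ r hg, algebraMap k _ r,
      Subalgebra.algebraMap_mem _ r, fun g _ => map_smul _ r g⟩
  | add D D' _ _ h h' =>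
    obtain ⟨h, E, hE, hDE⟩ := h
    obtain ⟨h', E', hE', hDE'⟩ := h'
    refine ⟨fun g hg => add_mem (h g hg) (h' g hg), E + E', add_mem hE hE', fun g hg => ?_⟩
    rw [LinearMap.add_apply, LinearMap.add_apply, map_add, hDE g hg, hDE' g hg]
  | mul D D' _ _ h h' =>
    obtain ⟨h, E, hE, hDE⟩ := h
    obtain ⟨h', E', hE', hDE'⟩ := h'
    refine ⟨fun g hg => h _ (h' g hg), E * E', mul_mem hE hE', fun g hg => ?_⟩
    rw [Module.End.mul_apply, Module.End.mul_apply, hDE _ (h' g hg), hDE' g hg]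

/-- The orders `1` and `p` have digits `(1, 0)` and `(0, 1)`, so they give the derivatives in `X_s`
and `Y_s`. -/
theorem exists_dividedDiffAlg_digitMap_eq [Field k] (hp : p.Prime) [CharP k p]
    {E : Module.End k (MvPolynomial (Fin n ⊕ Fin n) k)} (hE : E ∈ diffAlg (Fin n ⊕ Fin n) k) :
    ∃ D ∈ dividedDiffAlg (Fin n) k, ∀ g, digitMap p n k (D g) = E (digitMap p n k g) := by
  induction hE using Algebra.adjoin_induction with
  | mem E hE =>
    obtain ⟨s | s, rfl⟩ := hE
    · refine ⟨dividedDeriv k s 1, Algebra.subset_adjoin (Set.mem_range_self (s, 1)), fun g => ?_⟩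
      rw [digitMap_dividedDeriv hp, Nat.mod_eq_of_lt hp.one_lt, Nat.div_eq_of_lt hp.one_lt,
        dividedDeriv_zero, dividedDeriv_one]
      rfl
    · refine ⟨dividedDeriv k s p, Algebra.subset_adjoin (Set.mem_range_self (s, p)), fun g => ?_⟩
      rw [digitMap_dividedDeriv hp, Nat.mod_self, Nat.div_self hp.pos,
        dividedDeriv_zero, dividedDeriv_one]
      rfl
  | algebraMap r =>
    exact ⟨algebraMap k _ r, Subalgebra.algebraMap_mem _ r, fun g => map_smul _ r g⟩
  | add E E' _ _ h h' =>
    obtain ⟨D, hD, hDE⟩ := h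
    obtain ⟨D', hD', hDE'⟩ := h'
    refine ⟨D + D', add_mem hD hD', fun g => ?_⟩
    rw [LinearMap.add_apply, LinearMap.add_apply, map_add, hDE, hDE']
  | mul E E' _ _ h h' =>
    obtain ⟨D, hD, hDE⟩ := h
    obtain ⟨D', hD', hDE'⟩ := h'
    refine ⟨D * D', mul_mem hD hD', fun g => ?_⟩
    rw [Module.End.mul_apply, Module.End.mul_apply, hDE, hDE']

theorem map_digitMap_orbit [Field k] (hp : p.Prime) [CharP k p] {f : MvPolynomial (Fin n) k}
    (hf : f ∈ restrictDegree (Fin n) k (p ^ 2 - 1)) :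
    (orbit (dividedDiffAlg (Fin n) k) f).map (digitMap p n k)
      = orbit (diffAlg (Fin n ⊕ Fin n) k) (digitMap p n k f) := by
  ext w
  rw [Submodule.mem_map, mem_orbit]
  constructor
  · rintro ⟨g, hg, rfl⟩
    obtain ⟨D, hD, rfl⟩ := (mem_orbit _ _ _).1 hg
    obtain ⟨-, E, hE, h⟩ := exists_diffAlg_digitMap_eq hp hD
    exact ⟨E, hE, (h f hf).symm⟩
  · rintro ⟨E, hE, rfl⟩
    obtain ⟨D, hD, h⟩ := exists_dividedDiffAlg_digitMap_eq hp hE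
    exact ⟨D f, (mem_orbit _ _ _).2 ⟨D, hD, rfl⟩, h f⟩

end digitMap

/-! ### The Vandermonde determinant becomes `Δ` of the box. -/

theorem exists_vandermonde_eq_smul_sum (n : ℕ) (k : Type*) [Field k] :
    ∃ c : k, c ≠ 0 ∧ vandermonde n k = c • ∑ τ : Equiv.Perm (Fin n),
      ((Equiv.Perm.sign τ : ℤ) : k) •
        monomial (Finsupp.equivFunOnFinite.symm fun s => (τ s : ℕ)) 1 := by
  -- One sign for each pair `s < t`: `Matrix.det_vandermonde` has factors `X t - X s`.
  refine ⟨∏ s : Fin n, ∏ _t ∈ Finset.Ioi s, (-1 : k), by simp [Finset.prod_ne_zero_iff], ?_⟩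
  have h : ∑ τ : Equiv.Perm (Fin n), ((Equiv.Perm.sign τ : ℤ) : k) •
        (monomial (Finsupp.equivFunOnFinite.symm fun s => (τ s : ℕ)) 1 : MvPolynomial (Fin n) k)
      = (Matrix.vandermonde fun s : Fin n => (X s : MvPolynomial (Fin n) k)).det := by
    rw [← Matrix.det_transpose, Matrix.det_apply']
    refine Finset.sum_congr rfl fun τ _ => ?_
    rw [smul_eq_C_mul, map_intCast, monomial_eq, C_1, one_mul,
      Finsupp.prod_fintype _ _ fun _ => pow_zero _]
    rfl
  rw [h, Matrix.det_vandermonde, smul_eq_C_mul, map_prod, ← Finset.prod_mul_distrib, vandermonde]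
  refine Finset.prod_congr rfl fun s _ => ?_
  rw [map_prod, ← Finset.prod_mul_distrib]
  refine Finset.prod_congr rfl fun t _ => ?_
  simp

theorem vandermonde_mem_restrictDegree (n : ℕ) (k : Type*) [Field k] :
    vandermonde n k ∈ restrictDegree (Fin n) k (n - 1) := by
  classical
  obtain ⟨c, -, hc⟩ := exists_vandermonde_eq_smul_sum n k
  rw [hc]
  refine Submodule.smul_mem _ _ (Submodule.sum_mem _ fun τ _ => Submodule.smul_mem _ _ ?_)
  rw [mem_restrictDegree]
  intro b hb i
  rw [Finset.mem_singleton.1 (support_monomial_subset hb)]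
  exact Nat.le_sub_one_of_lt (τ i).2

theorem exists_digitMap_vandermonde_eq_smul {p : ℕ} (hp : 0 < p) (k : Type*) [Field k]
    (e : Fin (p ^ 2) ≃ diagram (box p)) :
    ∃ c : k, c ≠ 0 ∧
      digitMap p (p ^ 2) k (vandermonde (p ^ 2) k) = c • deltaPoly (box p) e k := by
  obtain ⟨c, hc0, hc⟩ := exists_vandermonde_eq_smul_sum (p ^ 2) k
  -- Base `p` digits give one ordering of the box; `f` compares it with `e`, and the sign of the
  -- resulting permutation enters the scalar.
  let f : Fin (p ^ 2) → Fin (p ^ 2) := fun t => e.symm ⟨((t : ℕ) % p, (t : ℕ) / p),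
    mem_diagram_box.2 ⟨Nat.mod_lt _ hp, Nat.div_lt_of_lt_mul (by rw [← pow_two]; exact t.2)⟩⟩
  have hef : ∀ t, (e (f t)).1 = ((t : ℕ) % p, (t : ℕ) / p) := fun t => by simp [f]
  have hf : Function.Injective f := fun s t hst => by
    have h := Prod.ext_iff.1 ((hef s).symm.trans ((congr_arg (fun i => (e i).1) hst).trans (hef t)))
    have h1 : (s : ℕ) % p = t % p := h.1
    have h2 : (s : ℕ) / p = t / p := h.2
    refine Fin.ext ?_
    rw [← Nat.mod_add_div (s : ℕ) p, ← Nat.mod_add_div (t : ℕ) p, h1, h2]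
  let π : Equiv.Perm (Fin (p ^ 2)) := Equiv.ofBijective f (Finite.injective_iff_bijective.1 hf)
  refine ⟨c * ((Equiv.Perm.sign π : ℤ) : k), mul_ne_zero hc0 ?_, ?_⟩
  · rcases Int.units_eq_one_or (Equiv.Perm.sign π) with h | h <;> simp [h]
  have hdet := Matrix.det_permute' π (Matrix.of fun s t : Fin (p ^ 2) =>
    (X (Sum.inl s) ^ (e t).1.1 * X (Sum.inr s) ^ (e t).1.2 :
      MvPolynomial (Fin (p ^ 2) ⊕ Fin (p ^ 2)) k))
  rw [mul_smul, hc, map_smul, map_sum]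
  congr 1
  rw [smul_eq_C_mul, map_intCast, deltaPoly]
  refine Eq.trans ?_ hdet
  have hsub : (Matrix.of fun s t : Fin (p ^ 2) =>
      (X (Sum.inl s) ^ (e t).1.1 * X (Sum.inr s) ^ (e t).1.2 :
        MvPolynomial (Fin (p ^ 2) ⊕ Fin (p ^ 2)) k)).submatrix id π
      = Matrix.of fun s t : Fin (p ^ 2) =>
        (X (Sum.inl s) ^ ((t : ℕ) % p) * X (Sum.inr s) ^ ((t : ℕ) / p)) := by
    ext1 s t
    change X (Sum.inl s) ^ (e (f t)).1.1 * X (Sum.inr s) ^ (e (f t)).1.2 = _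
    rw [hef]
    rfl
  rw [hsub, det_pow_mul_pow_eq_sum fun t : Fin (p ^ 2) => ((t : ℕ) % p, (t : ℕ) / p)]
  refine Finset.sum_congr rfl fun τ _ => ?_
  rw [map_smul, digitMap_monomial]
  rfl

theorem finrank_orbit_vandermonde_eq {p : ℕ} (hp : p.Prime) (k : Type*) [Field k] [CharP k p]
    (e : Fin (p ^ 2) ≃ diagram (box p)) :
    Module.finrank k (orbit (dividedDiffAlg (Fin (p ^ 2)) k) (vandermonde (p ^ 2) k))
      = Module.finrank k
          (orbit (diffAlg (Fin (p ^ 2) ⊕ Fin (p ^ 2)) k) (deltaPoly (box p) e k)) := by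
  obtain ⟨c, hc0, hc⟩ := exists_digitMap_vandermonde_eq_smul hp.pos k e
  rw [← orbit_smul_of_ne_zero _ hc0 (deltaPoly (box p) e k), ← hc,
    ← map_digitMap_orbit hp (vandermonde_mem_restrictDegree (p ^ 2) k)]
  exact (Submodule.equivMapOfInjective _ digitMap_injective _).finrank_eq

theorem map_deltaPoly {n : ℕ} (σ : n.Partition) (e : Fin n ≃ diagram σ) (k : Type*) [CommRing k] :
    map (Int.castRingHom k) (deltaPoly σ e ℤ) = deltaPoly σ e k := by
  rw [deltaPoly, deltaPoly, RingHom.map_det]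
  congr 1
  ext1 s t
  simp

end BoxPartition
end

theorem mainTheorem10 {p : ℕ} (hp : p.Prime) {k : Type*} [Field k] [CharP k p]
    (hconj : Module.finrank k
        (BoxPartition.orbit (BoxPartition.dividedDiffAlg (Fin (p ^ 2)) k)
          (BoxPartition.vandermonde (p ^ 2) k)) =
      Module.finrank ℂ
        (BoxPartition.orbit (BoxPartition.diffAlg (Fin (p ^ 2)) ℂ)
          (BoxPartition.vandermonde (p ^ 2) ℂ)))
    (e : Fin (p ^ 2) ≃ BoxPartition.diagram (BoxPartition.box p)) :
    Module.finrank k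
        (BoxPartition.orbit (BoxPartition.diffAlg (Fin (p ^ 2) ⊕ Fin (p ^ 2)) k)
          (BoxPartition.deltaPoly (BoxPartition.box p) e k)) = (p ^ 2)! ∧
      Module.finrank ℂ
        (BoxPartition.orbit (BoxPartition.diffAlg (Fin (p ^ 2) ⊕ Fin (p ^ 2)) ℂ)
          (BoxPartition.deltaPoly (BoxPartition.box p) e ℂ)) = (p ^ 2)! := by
  have hlower := BoxPartition.factorial_le_finrank_orbit_vandermonde (p ^ 2) ℂ
  rw [← hconj, BoxPartition.finrank_orbit_vandermonde_eq hp k e] at hlower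
  have hle := BoxPartition.finrank_orbit_map_le_of_charZero (k := k) (K := ℂ)
    (BoxPartition.deltaPoly (BoxPartition.box p) e ℤ)
  rw [BoxPartition.map_deltaPoly, BoxPartition.map_deltaPoly] at hle
  have hupper := BoxPartition.finrank_orbit_deltaPoly_box_le hp.pos
    (Complex.isPrimitiveRoot_exp p hp.ne_zero) e
  exact ⟨le_antisymm (hle.trans hupper) hlower, le_antisymm hupper (hlower.trans hle)⟩
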